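/- For integers $N,j\ge 0$ and $m\ge 1$ let $\binom{N,\,m}{j}$ denote the coefficient of $x^j$ in the expansion of $(1+x+\cdots+x^{m-1})^{N}$. Let $n\ge m\ge 1$ be integers and let $$d:=\varphi(n,m)=n+1-\left\lfloor\frac{n+1}{m+1}\right\rfloor-\left\lceil\frac{n+1}{m+1}\right\rceil ,$$ which is a nonnegative integer. Then: (1) For all $0\le k\le d$, $$\sum_{j=0}^k(-1)^{k-j}\binom{d-j}{k-j}\binom{n-j+1,\,m}{j}=\sum_{\ell=0}^{\lfloor k/m\rfloor}(-1)^{\ell}\sum_{j=m\ell}^{k}(-1)^{k-j}\binom{d-j}{k-j}\binom{n-j+1}{\ell}\binom{n-m\ell}{j-m\ell}.$$ (2) For all $0\le k\le d$, $$\sum_{j=0}^k(-1)^{k-j}\binom{d-j}{k-j}\binom{n-j+1,\,m}{j}\ge 0.$$ (3) For all $0\le k\le d+1$, $$\sum_{j=0}^k(-1)^{k-j}\binom{d+1-j}{k-j}\binom{n-j+1,\,m}{j}\le\binom{n-d+k-2}{k},$$ where $\binom{a}{0}=1$ for every integer $a$ (the upper entry equals $-1$ when $n=m$ and $k=0$).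 -/

import Mathlib

/-- The polynomial coefficient `binom(N, m; k)`: the coefficient of `x ^ k` in the expansion of
`(1 + x + ⋯ + x ^ (m - 1)) ^ N`. -/
noncomputable def polyCoeff (N m k : ℕ) : ℤ :=
  ((∑ i ∈ Finset.range m, (Polynomial.X : Polynomial ℤ) ^ i) ^ N).coeff k

/-- `φ(n, m) = n + 1 - ⌊(n + 1) / (m + 1)⌋ - ⌈(n + 1) / (m + 1)⌉`, with division in `ℚ`. -/
def pathPhi (n m : ℕ) : ℤ :=
  (n : ℤ) + 1 - ⌊((n : ℚ) + 1) / ((m : ℚ) + 1)⌋ - ⌈((n : ℚ) + 1) / ((m : ℚ) + 1)⌉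

/-- For `m ≥ 1` the integer `φ(n, m)` is a natural number. -/
theorem pathPhi_nonneg (n m : ℕ) (hm : 1 ≤ m) : 0 ≤ pathPhi n m := by
  have hm' : (1 : ℚ) ≤ m := by exact_mod_cast hm
  have hx : ((n : ℚ) + 1) / ((m : ℚ) + 1) ≤ ((n : ℚ) + 1) / 2 := by
    gcongr
    linarith
  have h1 := Int.floor_le (((n : ℚ) + 1) / ((m : ℚ) + 1))
  have h2 := Int.ceil_lt_add_one (((n : ℚ) + 1) / ((m : ℚ) + 1))
  have h3 : ((⌊((n : ℚ) + 1) / ((m : ℚ) + 1)⌋ + ⌈((n : ℚ) + 1) / ((m : ℚ) + 1)⌉ : ℤ) : ℚ)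
      < ((n : ℤ) + 2 : ℤ) := by
    push_cast
    linarith
  have h4 := Int.cast_lt.mp h3
  unfold pathPhi
  omega

/-! Put K_n = `kPoly m n` and p = n - d = `pathPd m n`. The sums in (2) and (3) are the coefficients
of K_n/(1-X)^p and K_n/(1-X)^(p-1), where `PowerSeries.mk 1` is 1/(1-X). So (2) says that the first
series is nonnegative up to degree d, and (3) follows from nonnegativity of (1-K_n)/(1-X)^(p-1).
Both come by induction on n from K_n = (1-X) ∑_{i<m} X^i K_{n-1-i} and its difference K_{n+1} = K_n
- (1-X) X^m K_{n-m}. Each factor 1-X cancels one pole, so only the growth of p has to be tracked.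
Part (1) is the expansion of (1-X^m)^N/(1-X)^N. -/

/-! ### Polynomial coefficients -/

open PowerSeries Finset in
theorem one_sub_X_pow_pow (m N : ℕ) : (1 - X ^ m : ℤ⟦X⟧) ^ N =
    ∑ l ∈ range (N + 1), X ^ (m * l) * C ((-1 : ℤ) ^ l * (N.choose l : ℤ)) := by
  rw [sub_eq_add_neg, add_comm, add_pow]
  refine sum_congr rfl fun l _ => ?_
  rw [one_pow, mul_one, neg_pow, ← pow_mul]
  simp
  ring

open PowerSeries Finset in
/-- Explicit form of the coefficients of `(1 + x + ⋯ + x ^ (m - 1)) ^ (n - j + 1)`. -/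
theorem polyCoeff_eq_sum {n m j : ℕ} (hm : 1 ≤ m) (hj : j ≤ n) :
    polyCoeff (n - j + 1) m j = ∑ l ∈ range (j / m + 1), (-1 : ℤ) ^ l *
      ((n - j + 1).choose l : ℤ) * ((n - m * l).choose (j - m * l) : ℤ) := by
  set N := n - j + 1 with hN
  have hgeom : (∑ i ∈ range m, (X : ℤ⟦X⟧) ^ i) = (1 - X ^ m) * PowerSeries.mk 1 := by
    rw [← mul_neg_geom_sum, mul_comm, ← mul_assoc, mk_one_mul_one_sub_eq_one, one_mul]
  have hcoe : polyCoeff N m j = coeff j ((∑ i ∈ range m, (X : ℤ⟦X⟧) ^ i) ^ N) := by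
    have : ((∑ i ∈ range m, (X : ℤ⟦X⟧) ^ i) ^ N) =
        ((((∑ i ∈ range m, (Polynomial.X : Polynomial ℤ) ^ i) ^ N : Polynomial ℤ)) : ℤ⟦X⟧) := by
      rw [← Polynomial.coeToPowerSeries.ringHom_apply]
      simp only [map_pow, map_sum]
      simp
    rw [this, Polynomial.coeff_coe, polyCoeff]
  have hterm : ∀ l, coeff j (X ^ (m * l) * C ((-1 : ℤ) ^ l * (N.choose l : ℤ)) * PowerSeries.mk 1 ^ N) =
      if l ≤ j / m then (-1 : ℤ) ^ l * (N.choose l : ℤ) * ((n - m * l).choose (j - m * l) : ℤ)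
      else 0 := by
    intro l
    have hiff : l ≤ j / m ↔ m * l ≤ j := by rw [Nat.le_div_iff_mul_le hm, mul_comm]
    rw [mul_assoc, coeff_X_pow_mul', coeff_C_mul, hN, mk_one_pow_eq_mk_choose_add, coeff_mk]
    simp only [hiff]
    split_ifs with h
    · rw [show n - j + (j - m * l) = n - m * l by omega,
        Nat.choose_symm_of_eq_add (show n - m * l = (n - j) + (j - m * l) by omega)]
    · rfl
  rw [hcoe, hgeom, mul_pow, one_sub_X_pow_pow, sum_mul, map_sum, sum_congr rfl fun l _ => hterm l]
  rw [← sum_filter]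
  refine sum_subset_zero_on_sdiff (fun l hl => ?_) (fun l hl => ?_) (fun _ _ => rfl)
  · simp only [mem_filter, mem_range] at hl ⊢
    omega
  -- The target range may exceed N; there the binomial `N.choose l` vanishes.
  · simp only [mem_sdiff, mem_filter, mem_range, not_and] at hl
    rw [Nat.choose_eq_zero_of_lt (n := N) (by omega)]
    simp

open PowerSeries Finset in
/-- The coefficients satisfy the recursion obtained by splitting off one factor. -/
theorem polyCoeff_succ (N m j : ℕ) :
    polyCoeff (N + 1) m j =
      ∑ i ∈ range m, if i ≤ j then polyCoeff N m (j - i) else 0 := by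
  unfold polyCoeff
  rw [pow_succ, mul_comm, sum_mul, Polynomial.finsetSum_coeff]
  refine sum_congr rfl fun i _ => ?_
  rw [Polynomial.coeff_X_pow_mul']

/-! ### The numerators and their recursions -/

open PowerSeries Finset in
/-- `(1 - X) ^ n` times the Hilbert series of the Stanley-Reisner ring of the complex of subsets of
`{1, …, n}` without `m` consecutive elements. -/
noncomputable def kPoly (m n : ℕ) : ℤ⟦X⟧ :=
  ∑ j ∈ range (n + 1), C (polyCoeff (n - j + 1) m j) * X ^ j * (1 - X) ^ (n - j)

open PowerSeries Finset in
theorem kPoly_of_lt {m n : ℕ} (h : n < m) : kPoly m n = 1 := by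
  have h1 : ((X : ℤ⟦X⟧) + (1 - X)) ^ n = 1 := by simp
  rw [← h1, add_pow, kPoly]
  refine sum_congr rfl fun j hj => ?_
  rw [mem_range] at hj
  rw [polyCoeff_eq_sum (by omega) (by omega), Nat.div_eq_of_lt (by omega)]
  simp
  ring

theorem polyCoeff_one_of_le {m n : ℕ} (h : m ≤ n) : polyCoeff 1 m n = 0 := by
  unfold polyCoeff
  rw [pow_one, Polynomial.finsetSum_coeff]
  refine Finset.sum_eq_zero fun i hi => ?_
  rw [Finset.mem_range] at hi
  rw [Polynomial.coeff_X_pow, if_neg (by omega)]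

open PowerSeries Finset in
theorem kPoly_eq_sum {m n : ℕ} (h : m ≤ n) :
    kPoly m n = (1 - X) * ∑ i ∈ range m, X ^ i * kPoly m (n - 1 - i) := by
  -- The term j = n, the only one without a factor 1 - X, vanishes because n ≥ m.
  rw [kPoly, sum_range_succ, Nat.sub_self, zero_add, polyCoeff_one_of_le h]
  simp only [map_zero, zero_mul, add_zero]
  have h1 : ∀ j ∈ range n, C (polyCoeff (n - j + 1) m j) * X ^ j * (1 - X : ℤ⟦X⟧) ^ (n - j) =
      ∑ i ∈ range m, if i ≤ j then
        C (polyCoeff (n - j) m (j - i)) * X ^ j * (1 - X) ^ (n - j) else 0 := by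
    intro j _
    rw [polyCoeff_succ, map_sum, sum_mul, sum_mul]
    refine sum_congr rfl fun i _ => ?_
    split_ifs <;> simp
  rw [sum_congr rfl h1, sum_comm, mul_sum]
  refine sum_congr rfl fun i hi => ?_
  rw [mem_range] at hi
  rw [kPoly, show n - 1 - i + 1 = n - i by omega, mul_sum, mul_sum, ← sum_filter]
  symm
  refine sum_bij (fun j _ => j + i) ?_ ?_ ?_ ?_
  · intro j hj
    simp only [mem_range, mem_filter] at hj ⊢
    omega
  · intro a _ b _ hab
    exact Nat.add_right_cancel hab
  · intro b hb
    simp only [mem_range, mem_filter] at hb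
    exact ⟨b - i, by rw [mem_range]; omega, by omega⟩
  · intro j hj
    rw [mem_range] at hj
    rw [show n - 1 - i - j + 1 = n - (j + i) by omega, Nat.add_sub_cancel,
      show n - (j + i) = n - 1 - i - j + 1 by omega]
    ring

open PowerSeries Finset in
theorem kPoly_add_one {m n : ℕ} (h : m ≤ n) :
    kPoly m (n + 1) = kPoly m n - (1 - X) * X ^ m * kPoly m (n - m) := by
  have h1 := kPoly_eq_sum (Nat.le_succ_of_le h)
  have h2 := kPoly_eq_sum h
  rw [Nat.succ_eq_add_one, Nat.add_sub_cancel] at h1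
  have h3 : (∑ i ∈ range m, X ^ i * kPoly m (n - i)) + X ^ m * kPoly m (n - m) =
      X * (∑ i ∈ range m, X ^ i * kPoly m (n - 1 - i)) + kPoly m n := by
    rw [← sum_range_succ (fun i => X ^ i * kPoly m (n - i)), sum_range_succ', mul_sum]
    simp only [pow_zero, one_mul, Nat.sub_zero]
    congr 1
    refine sum_congr rfl fun i _ => ?_
    rw [show n - (i + 1) = n - 1 - i by omega]
    ring
  rw [h1]
  linear_combination (1 - X) * h3 - X * h2

open PowerSeries Finset in
/-- Iterated form of `kPoly_add_one`, expanded with nonnegative weights. -/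
theorem kPoly_add {m N r : ℕ} (hN : m + 1 ≤ N) (hr : r ≤ m) :
    kPoly m (N + r) = (1 - X) * ∑ j ∈ range m,
      (if j + r < m then X ^ j else (1 - X) * X ^ j * ∑ i ∈ range (m - j), X ^ i) *
        kPoly m (N - 1 - j) := by
  induction r with
  | zero =>
    rw [add_zero, kPoly_eq_sum (by omega)]
    congr 1
    refine sum_congr rfl fun j hj => ?_
    rw [mem_range] at hj
    rw [if_pos (by omega)]
  | succ r ih =>
    rw [← add_assoc, kPoly_add_one (by omega), ih (by omega)]
    -- Only at j = m - 1 - r does the weight change from r to r + 1: it loses X^m, which is the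
    -- correction in `kPoly_add_one`.
    have hmem : m - 1 - r ∈ range m := by rw [mem_range]; omega
    rw [← add_sum_erase _ _ hmem, ← add_sum_erase _ _ hmem, if_pos (by omega), if_neg (by omega),
      show N - 1 - (m - 1 - r) = N + r - m by omega]
    have hg : (1 - X : ℤ⟦X⟧) * X ^ (m - 1 - r) * ∑ i ∈ range (m - (m - 1 - r)), X ^ i =
        X ^ (m - 1 - r) - X ^ m := by
      have hp : (X : ℤ⟦X⟧) ^ m = X ^ (m - 1 - r) * X ^ (m - (m - 1 - r)) := by
        rw [← pow_add]; congr 1; omega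
      rw [hp]
      linear_combination (X ^ (m - 1 - r)) * mul_neg_geom_sum (X : ℤ⟦X⟧) (m - (m - 1 - r))
    rw [hg]
    have hs : ∀ j ∈ (range m).erase (m - 1 - r),
        (if j + r < m then X ^ j else (1 - X : ℤ⟦X⟧) * X ^ j * ∑ i ∈ range (m - j), X ^ i) *
          kPoly m (N - 1 - j) =
        (if j + (r + 1) < m then X ^ j else (1 - X) * X ^ j * ∑ i ∈ range (m - j), X ^ i) *
          kPoly m (N - 1 - j) := by
      intro j hj
      rw [mem_erase, mem_range] at hj
      have : (j + r < m) ↔ (j + (r + 1) < m) := by omega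
      simp only [this]
    rw [sum_congr rfl hs]
    ring

/-! ### Nonnegative series and pole orders -/

open PowerSeries Finset in
/-- Power series with nonnegative integer coefficients. -/
def nonnegSeries : Subsemiring ℤ⟦X⟧ where
  carrier := {f | ∀ k, 0 ≤ coeff k f}
  mul_mem' ha hb k := by
    rw [coeff_mul]
    exact sum_nonneg fun x _ => mul_nonneg (ha _) (hb _)
  one_mem' k := by
    rw [coeff_one]
    split_ifs <;> simp
  add_mem' ha hb k := by
    rw [map_add]
    exact add_nonneg (ha k) (hb k)
  zero_mem' k := by simp

open PowerSeries

theorem X_mem_nonnegSeries : (X : ℤ⟦X⟧) ∈ nonnegSeries := fun k => by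
  rw [coeff_X]
  split_ifs <;> simp

theorem mk_one_mem_nonnegSeries : (PowerSeries.mk 1 : ℤ⟦X⟧) ∈ nonnegSeries := fun k => by simp

theorem mul_mk_one_pow_mem {f : ℤ⟦X⟧} {a b : ℕ} (h : f * PowerSeries.mk 1 ^ a ∈ nonnegSeries) (hab : a ≤ b) :
    f * PowerSeries.mk 1 ^ b ∈ nonnegSeries := by
  obtain ⟨c, rfl⟩ := Nat.exists_eq_add_of_le hab
  rw [pow_add, ← mul_assoc]
  exact mul_mem h (pow_mem mk_one_mem_nonnegSeries c)

theorem one_sub_X_mul_mul_mk_one_pow (f : ℤ⟦X⟧) (a : ℕ) :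
    (1 - X) * f * PowerSeries.mk 1 ^ (a + 1) = f * PowerSeries.mk 1 ^ a := by
  have h := mk_one_mul_one_sub_eq_one ℤ
  rw [pow_succ]
  linear_combination (f * PowerSeries.mk 1 ^ a) * h

theorem one_sub_X_mul_mem {f : ℤ⟦X⟧} {a b : ℕ} (h : f * PowerSeries.mk 1 ^ a ∈ nonnegSeries) (hab : a + 1 ≤ b) :
    (1 - X) * f * PowerSeries.mk 1 ^ b ∈ nonnegSeries := by
  refine mul_mk_one_pow_mem ?_ hab
  rwa [one_sub_X_mul_mul_mk_one_pow]

theorem mul_mul_mk_one_pow_mem {f g : ℤ⟦X⟧} {a : ℕ} (hf : f ∈ nonnegSeries)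
    (h : g * PowerSeries.mk 1 ^ a ∈ nonnegSeries) : f * g * PowerSeries.mk 1 ^ a ∈ nonnegSeries := by
  rw [mul_assoc]
  exact mul_mem hf h

open Finset in
theorem sum_mul_mk_one_pow_mem {ι : Type*} {s : Finset ι} {f : ι → ℤ⟦X⟧} {a : ℕ}
    (h : ∀ i ∈ s, f i * PowerSeries.mk 1 ^ a ∈ nonnegSeries) : (∑ i ∈ s, f i) * PowerSeries.mk 1 ^ a ∈ nonnegSeries := by
  rw [sum_mul]
  exact sum_mem h

/-- The number `n - φ(n, m)`. -/
def pathPd (m n : ℕ) : ℕ := (n + 1) / (m + 1) + n / (m + 1)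

theorem pathPd_mono (m : ℕ) : Monotone (pathPd m) := fun _ _ h =>
  add_le_add (Nat.div_le_div_right (Nat.succ_le_succ h)) (Nat.div_le_div_right h)

theorem pathPd_add_period (m n : ℕ) : pathPd m (n + (m + 1)) = pathPd m n + 2 := by
  unfold pathPd
  rw [show n + (m + 1) + 1 = n + 1 + (m + 1) by ring, Nat.add_div_right _ m.succ_pos,
    Nat.add_div_right _ m.succ_pos, Nat.succ_eq_add_one]
  omega

theorem pathPd_block {m r : ℕ} (q : ℕ) (hr : r < m) : pathPd m ((m + 1) * q + r) = 2 * q := by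
  unfold pathPd
  rw [add_assoc, Nat.mul_add_div m.succ_pos, Nat.mul_add_div m.succ_pos,
    Nat.div_eq_of_lt (a := r + 1) (by omega), Nat.div_eq_of_lt (a := r) (by omega)]
  omega

theorem pathPd_block_last (m q : ℕ) : pathPd m ((m + 1) * q + m) = 2 * q + 1 := by
  unfold pathPd
  rw [add_assoc, Nat.mul_add_div m.succ_pos, Nat.mul_add_div m.succ_pos,
    Nat.div_self m.succ_pos, Nat.div_eq_of_lt (a := m) (by omega)]
  omega

-- Write n = (m+1)q + r. For r = m the basic recursion suffices, since p jumps by one there. For r <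
-- m it could lose a pole too many, so `kPoly_add` steps back to the previous block.
open Finset in
theorem kPoly_mul_mem (m n : ℕ) :
    kPoly m n * PowerSeries.mk 1 ^ pathPd m n ∈ nonnegSeries := by
  induction n using Nat.strong_induction_on with
  | _ n ih =>
  rcases lt_or_ge n m with hnm | hnm
  · rw [kPoly_of_lt hnm, one_mul]
    exact pow_mem mk_one_mem_nonnegSeries _
  obtain ⟨q, r, hr, rfl⟩ : ∃ q r, r < m + 1 ∧ n = (m + 1) * q + r :=
    ⟨n / (m + 1), n % (m + 1), Nat.mod_lt _ m.succ_pos, (Nat.div_add_mod _ _).symm⟩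
  rcases Nat.lt_succ_iff_lt_or_eq.mp hr with hrm | rfl
  · obtain ⟨q, rfl⟩ : ∃ q', q = q' + 1 := ⟨q - 1, by
      rcases Nat.eq_zero_or_pos q with rfl | h
      · omega
      · omega⟩
    have hN : (m + 1) * (q + 1) = (m + 1) * q + m + 1 := by ring
    rw [kPoly_add (by omega) hrm.le, pathPd_block _ hrm]
    have hpow (j : ℕ) : (X : ℤ⟦X⟧) ^ j ∈ nonnegSeries := pow_mem X_mem_nonnegSeries j
    refine one_sub_X_mul_mem (a := 2 * q + 1) (sum_mul_mk_one_pow_mem fun j hj => ?_) (by omega)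
    rw [mem_range] at hj
    have hIH := ih ((m + 1) * (q + 1) - 1 - j) (by omega)
    have hidx : (m + 1) * (q + 1) - 1 - j = (m + 1) * q + (m - j) := by omega
    rw [hidx] at hIH ⊢
    split_ifs with hjr
    · refine mul_mul_mk_one_pow_mem (hpow j) (mul_mk_one_pow_mem hIH ?_)
      rw [← pathPd_block_last]
      exact pathPd_mono m (by omega)
    -- Here j ≥ 1 because r < m, so the index misses the end of its block and the pole order is only
    -- 2q; this leaves room for the second factor 1 - X.
    · rw [pathPd_block _ (by omega)] at hIH
      have hS : X ^ j * ∑ i ∈ Finset.range (m - j), X ^ i ∈ nonnegSeries :=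
        mul_mem (hpow j) (sum_mem fun i _ => hpow i)
      have h := one_sub_X_mul_mem (mul_mul_mk_one_pow_mem hS hIH) le_rfl
      simpa only [mul_assoc] using h
  · rw [kPoly_eq_sum (by omega), pathPd_block_last]
    refine one_sub_X_mul_mem (a := 2 * q) (sum_mul_mk_one_pow_mem fun j hj => ?_) le_rfl
    rw [mem_range] at hj
    refine mul_mul_mk_one_pow_mem (pow_mem X_mem_nonnegSeries j)
      (mul_mk_one_pow_mem (ih _ (by omega)) ?_)
    rw [← pathPd_block q (show r - 1 < r by omega)]
    exact pathPd_mono r (by omega)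

/-- Each step adds (1-X) X^m K_{n-m} to 1 - K_n, and p(n+1) - 1 = p(n-m) + 1 is exactly the order
this needs. -/
theorem one_sub_kPoly_mul_mem {m n : ℕ} (h : m ≤ n) :
    (1 - kPoly m n) * PowerSeries.mk 1 ^ (pathPd m n - 1) ∈ nonnegSeries := by
  induction n, h using Nat.le_induction with
  | base =>
    have hK : 1 - kPoly m m = X ^ m := by
      have : ∀ i ∈ Finset.range m, X ^ i * kPoly m (m - 1 - i) = X ^ i := fun i hi => by
        rw [Finset.mem_range] at hi
        rw [kPoly_of_lt (by omega), mul_one]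
      rw [kPoly_eq_sum le_rfl, Finset.sum_congr rfl this, mul_neg_geom_sum]
      ring
    rw [hK]
    exact mul_mem (pow_mem X_mem_nonnegSeries _) (pow_mem mk_one_mem_nonnegSeries _)
  | succ n h ih =>
    have hp : pathPd m (n + 1) = pathPd m (n - m) + 2 := by
      rw [← pathPd_add_period]
      congr 1
      omega
    have hmono := pathPd_mono m (Nat.le_succ n)
    rw [kPoly_add_one h, show (1 : ℤ⟦X⟧) - (kPoly m n - (1 - X) * X ^ m * kPoly m (n - m)) =
      (1 - kPoly m n) + (1 - X) * (X ^ m * kPoly m (n - m)) by ring, add_mul]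
    refine add_mem (mul_mk_one_pow_mem ih (Nat.sub_le_sub_right hmono 1)) ?_
    exact one_sub_X_mul_mem (mul_mul_mk_one_pow_mem (pow_mem X_mem_nonnegSeries m)
      (kPoly_mul_mem m (n - m))) (by omega)

/-! ### From series back to binomial sums -/

theorem coeff_one_sub_X_pow (a k : ℕ) :
    coeff k ((1 - X : ℤ⟦X⟧) ^ a) = (-1) ^ k * (a.choose k : ℤ) := by
  have h := one_sub_X_pow_pow 1 a
  rw [pow_one] at h
  rw [h, map_sum]
  simp only [one_mul, coeff_mul_C, coeff_X_pow, ite_mul, zero_mul, Finset.sum_ite_eq,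
    Finset.mem_range]
  split_ifs with hk
  · rfl
  · rw [Nat.choose_eq_zero_of_lt (by omega)]
    simp

open Finset in
theorem sum_choose_mul_polyCoeff_eq_coeff {n e k : ℕ} (m : ℕ) (he : e ≤ n) (hk : k ≤ e) :
    ∑ j ∈ range (k + 1),
        (-1 : ℤ) ^ (k - j) * ((e - j).choose (k - j) : ℤ) * polyCoeff (n - j + 1) m j =
      coeff k (kPoly m n * PowerSeries.mk 1 ^ (n - e)) := by
  rw [kPoly, sum_mul, map_sum]
  refine sum_subset_zero_on_sdiff (range_subset_range.mpr (by omega)) (fun j hj => ?_)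
    fun j hj => ?_
  · simp only [mem_sdiff, mem_range] at hj
    rw [mul_assoc, mul_assoc, coeff_C_mul, coeff_X_pow_mul', if_neg (by omega), mul_zero]
  · rw [mem_range] at hj
    have hcancel : (1 - X : ℤ⟦X⟧) ^ (n - j) * PowerSeries.mk 1 ^ (n - e) = (1 - X) ^ (e - j) := by
      rw [show n - j = (e - j) + (n - e) by omega, pow_add, mul_assoc, ← mul_pow, mul_comm (1 - X),
        mk_one_mul_one_sub_eq_one, one_pow, mul_one]
    rw [mul_assoc (_ * _), hcancel, mul_assoc (C _), coeff_C_mul, coeff_X_pow_mul',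
      if_pos (by omega), coeff_one_sub_X_pow]
    ring

theorem coeff_mk_one_pow (e k : ℕ) :
    coeff k ((PowerSeries.mk 1 : ℤ⟦X⟧) ^ e) = Ring.choose ((e : ℤ) + k - 1) k := by
  rcases e with _ | e
  -- For e = k = 0 the upper entry is -1, which is why `Ring.choose` over ℤ is used.
  · rcases k with _ | k
    · simp
    · rw [pow_zero, coeff_one, if_neg k.succ_ne_zero,
        show ((0 : ℕ) : ℤ) + ((k + 1 : ℕ) : ℤ) - 1 = (k : ℤ) by push_cast; ring,
        Ring.choose_natCast, Nat.choose_succ_self, Nat.cast_zero]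
  · rw [mk_one_pow_eq_mk_choose_add, coeff_mk,
      show ((e + 1 : ℕ) : ℤ) + (k : ℤ) - 1 = ((e + k : ℕ) : ℤ) by push_cast; ring,
      Ring.choose_natCast, Nat.choose_symm_add]

theorem pathPhi_eq (n m : ℕ) : pathPhi n m = (n : ℤ) - pathPd m n := by
  have h1 : ⌊((n : ℚ) + 1) / ((m : ℚ) + 1)⌋ = (((n + 1) / (m + 1) : ℕ) : ℤ) := by
    have := Rat.floor_natCast_div_natCast (n + 1) (m + 1)
    push_cast at this ⊢
    exact this
  obtain ⟨c, hc⟩ : ∃ c, c = n / (m + 1) := ⟨_, rfl⟩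
  -- The ceiling of (n+1)/(m+1) is ⌊n/(m+1)⌋ + 1.
  have h2 : ⌈((n : ℚ) + 1) / ((m : ℚ) + 1)⌉ = (c : ℤ) + 1 := by
    have hpos : (0 : ℚ) < (m : ℚ) + 1 := by positivity
    have hdm : (m + 1) * c + n % (m + 1) = n := hc ▸ Nat.div_add_mod _ _
    have hlt : n % (m + 1) < m + 1 := Nat.mod_lt _ m.succ_pos
    have hle1 : (m + 1) * c < n + 1 := by omega
    have hle2 : n + 1 ≤ (m + 1) * c + (m + 1) := by omega
    rw [Int.ceil_eq_iff]
    constructor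
    · rw [lt_div_iff₀ hpos]
      have : (((m + 1) * c : ℕ) : ℚ) < ((n + 1 : ℕ) : ℚ) := Nat.cast_lt.mpr hle1
      push_cast at this ⊢
      linarith
    · rw [div_le_iff₀ hpos]
      have : ((n + 1 : ℕ) : ℚ) ≤ (((m + 1) * c + (m + 1) : ℕ) : ℚ) :=
        Nat.cast_le.mpr hle2
      push_cast at this ⊢
      linarith
  rw [pathPhi, h1, h2, pathPd, ← hc]
  push_cast
  ring

theorem theoremt31 (n m : ℕ) (hm : 1 ≤ m) (hmn : m ≤ n)
    (d : ℕ) (hd : (d : ℤ) = pathPhi n m) :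
    (∀ k : ℕ, k ≤ d →
      ∑ j ∈ Finset.range (k + 1),
          (-1 : ℤ) ^ (k - j) * ((d - j).choose (k - j) : ℤ) * polyCoeff (n - j + 1) m j
        = ∑ l ∈ Finset.range (k / m + 1), (-1 : ℤ) ^ l *
            ∑ j ∈ Finset.Icc (m * l) k,
              (-1 : ℤ) ^ (k - j) * ((d - j).choose (k - j) : ℤ) *
                ((n - j + 1).choose l : ℤ) * ((n - m * l).choose (j - m * l) : ℤ)) ∧
    (∀ k : ℕ, k ≤ d →
      0 ≤ ∑ j ∈ Finset.range (k + 1),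
          (-1 : ℤ) ^ (k - j) * ((d - j).choose (k - j) : ℤ) * polyCoeff (n - j + 1) m j) ∧
    (∀ k : ℕ, k ≤ d + 1 →
      ∑ j ∈ Finset.range (k + 1),
          (-1 : ℤ) ^ (k - j) * ((d + 1 - j).choose (k - j) : ℤ) * polyCoeff (n - j + 1) m j
        ≤ Ring.choose ((n : ℤ) - d + k - 2) k) := by
  have hpd : d + pathPd m n = n := by
    rw [pathPhi_eq] at hd
    omega
  have hpos : 1 ≤ pathPd m n :=
    le_add_right ((Nat.one_le_div_iff m.succ_pos).mpr (Nat.succ_le_succ hmn))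
  refine ⟨fun k hk => ?_, fun k hk => ?_, fun k hk => ?_⟩
  · have h1 : ∀ j ∈ Finset.range (k + 1),
        (-1 : ℤ) ^ (k - j) * ((d - j).choose (k - j) : ℤ) * polyCoeff (n - j + 1) m j =
        ∑ l ∈ Finset.range (j / m + 1), (-1 : ℤ) ^ l * ((-1 : ℤ) ^ (k - j) *
          ((d - j).choose (k - j) : ℤ) * ((n - j + 1).choose l : ℤ) *
            ((n - m * l).choose (j - m * l) : ℤ)) := by
      intro j hj
      rw [Finset.mem_range] at hj
      rw [polyCoeff_eq_sum hm (by omega), Finset.mul_sum]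
      exact Finset.sum_congr rfl fun l _ => by ring
    rw [Finset.sum_congr rfl h1]
    simp only [Finset.mul_sum]
    refine Finset.sum_comm' fun j l => ?_
    simp only [Finset.mem_range, Finset.mem_Icc, Nat.lt_succ_iff, Nat.le_div_iff_mul_le hm,
      mul_comm l m]
    omega
  · rw [sum_choose_mul_polyCoeff_eq_coeff m (by omega) hk, show n - d = pathPd m n by omega]
    exact kPoly_mul_mem m n k
  · have h := one_sub_kPoly_mul_mem hmn k
    rw [sub_mul, one_mul, map_sub, coeff_mk_one_pow] at h
    rw [sum_choose_mul_polyCoeff_eq_coeff m (by omega) hk,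
      show n - (d + 1) = pathPd m n - 1 by omega,
      show (n : ℤ) - d + k - 2 = ((pathPd m n - 1 : ℕ) : ℤ) + k - 1 by omega]
    linarith
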